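/- Let $K$ be a field and let $E=(E^0,E^1,r,s)$ be a directed graph, with sets $E^0$ of vertices and $E^1$ of edges (of arbitrary cardinality) and source and range maps $s,r\colon E^1\to E^0$. The Leavitt path algebra $L_K(E)$ is the associative, not necessarily unital, $K$-algebra generated by $E^0\cup\{e,e^*\mid e\in E^1\}$ subject to the relations $vw=\delta_{v,w}v$ for $v,w\in E^0$; $s(e)e=er(e)=e$ and $r(e)e^*=e^*s(e)=e^*$ for $e\in E^1$; $e^*f=\delta_{e,f}r(e)$ for $e,f\in E^1$; and $v=\sum_{e\in s^{-1}(v)}ee^*$ for every $v\in E^0$ such that $s^{-1}(v)$ is finite and non-empty. The graph $E$ is called row-finite if $s^{-1}(v)$ is finite for every $v\in E^0$, and acyclic if it has no cycles, where a cycle is a path $e_1\cdots e_n$ ($n\ge 1$, $r(e_i)=s(e_{i+1})$ for $1\le i<n$) with $r(e_n)=s(e_1)$ and $s(e_i)\ne s(e_j)$ for $i\ne j$. A subset $H\subseteq E^0$ is called hereditary if $v\in H$ whenever there is a path (possibly of length $0$) from some $u\in H$ to $v$, and saturated if $v\in H$ for every $v\in E^0$ such that $s^{-1}(v)$ is finite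 and non-empty and $r(s^{-1}(v))\subseteq H$. If $E$ is acyclic and row-finite, then there is an order isomorphism between the lattice of all hereditary saturated subsets of $E^0$ and the lattice of all (two-sided) ideals of $L_K(E)$, both ordered by inclusion. In particular, for an arbitrary directed graph $E$, there is such an order isomorphism whenever $L_K(E)$ is a commutator ring, that is, whenever $L_K(E)=[L_K(E),L_K(E)]$, where $[R,R]$ denotes the additive subgroup of $R$ generated by all $xy-yx$ with $x,y\in R$. -/

import Mathlib

universe u v w

/-- A directed graph with vertex set `V` and edge set `E` (loops and multiple edges are allowed),
given by its source and range maps. -/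
structure DirectedGraph (V : Type u) (E : Type v) where
  /-- The source of an edge. -/
  s : E → V
  /-- The range of an edge. -/
  r : E → V

namespace DirectedGraph

variable {V : Type u} {E : Type v}

/-- `G.IsPath a p b`: the list of edges `p = e₁ … eₙ` is a path with source `a` and range `b`.
The empty list at `a` is the path of length `0` at `a`. -/
def IsPath (G : DirectedGraph V E) : V → List E → V → Prop
  | a, [], b => a = b
  | a, e :: p, b => G.s e = a ∧ G.IsPath (G.r e) p b

/-- A cycle is a closed path of positive length whose edges have pairwise distinct sources. -/
def IsCycle (G : DirectedGraph V E) (p : List E) : Prop :=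
  p ≠ [] ∧ (∃ a, G.IsPath a p a) ∧ (p.map G.s).Nodup

/-- A graph is acyclic if it has no cycles. -/
def Acyclic (G : DirectedGraph V E) : Prop :=
  ∀ p : List E, ¬ G.IsCycle p

/-- A graph is row-finite if each vertex is the source of only finitely many edges. -/
def RowFinite (G : DirectedGraph V E) : Prop :=
  ∀ a : V, {e : E | G.s e = a}.Finite

/-- A set of vertices is hereditary if it contains every vertex that can be reached by a path
from one of its elements. -/
def Hereditary (G : DirectedGraph V E) (H : Set V) : Prop :=
  ∀ a b : V, a ∈ H → (∃ p : List E, G.IsPath a p b) → b ∈ H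

/-- A set of vertices is saturated if it contains every vertex `a` that is the source of at least
one and only finitely many edges, and for which the ranges of all these edges lie in the set. -/
def Saturated (G : DirectedGraph V E) (H : Set V) : Prop :=
  ∀ a : V, {e : E | G.s e = a}.Nonempty → {e : E | G.s e = a}.Finite →
    (∀ e : E, G.s e = a → G.r e ∈ H) → a ∈ H

/-- The hereditary saturated sets of vertices, ordered by inclusion. -/
abbrev HereditarySaturated (G : DirectedGraph V E) : Type u :=
  {H : Set V // G.Hereditary H ∧ G.Saturated H}

/-- The intersection of hereditary saturated sets is hereditary and saturated. -/
instance (G : DirectedGraph V E) : InfSet G.HereditarySaturated where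
  sInf S := ⟨{a | ∀ H ∈ S, a ∈ H.1},
    fun a b ha hab H hH => H.2.1 a b (ha H hH) hab,
    fun a hn hf h H hH => H.2.2 a hn hf fun e he => h e he H hH⟩

/-- The hereditary saturated sets form a (complete) lattice with respect to inclusion. -/
instance (G : DirectedGraph V E) : CompleteLattice G.HereditarySaturated :=
  completeLatticeOfInf _ fun _ =>
    ⟨fun H hH _ ha => ha H hH, fun _ hT _ ha _ hH => hT hH ha⟩

end DirectedGraph

/-- The generators of a Leavitt path algebra: the vertices `a`, the edges `e`, and the ghost
edges `e*`. -/
inductive LeavittGen (V : Type u) (E : Type v) : Type (max u v)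
  | vertex (a : V)
  | edge (e : E)
  | ghost (e : E)

/-- The free associative non-unital `K`-algebra on the vertices, edges and ghost edges, i.e. the
semigroup algebra over `K` of the free semigroup on these generators. -/
abbrev LeavittFree (K : Type w) [Field K] (V : Type u) (E : Type v) : Type (max u v w) :=
  MonoidAlgebra K (FreeSemigroup (LeavittGen V E))

namespace LeavittFree

variable (K : Type w) [Field K] {V : Type u} {E : Type v}

/-- A generator as an element of the free algebra. -/
noncomputable def gen (x : LeavittGen V E) : LeavittFree K V E :=
  MonoidAlgebra.single (FreeSemigroup.of x) 1

/-- The generator given by a vertex. -/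
noncomputable def vtx (a : V) : LeavittFree K V E := gen K (.vertex a)

/-- The generator given by an edge. -/
noncomputable def edge (e : E) : LeavittFree K V E := gen K (.edge e)

/-- The generator given by a ghost edge. -/
noncomputable def ghost (e : E) : LeavittFree K V E := gen K (.ghost e)

end LeavittFree

namespace DirectedGraph

variable {V : Type u} {E : Type v}

open LeavittFree in
/-- The defining relations (V), (E1), (E2), (CK1), (CK2) of the Leavitt path algebra, together
with their scalar multiples, so that the ring congruence they generate is a `K`-algebra
congruence. -/
inductive LeavittRel (K : Type w) [Field K] (G : DirectedGraph V E) :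
    LeavittFree K V E → LeavittFree K V E → Prop
  | vertex_self (a : V) : LeavittRel K G (vtx K a * vtx K a) (vtx K a)
  | vertex_ne (a b : V) (h : a ≠ b) : LeavittRel K G (vtx K a * vtx K b) 0
  | source_edge (e : E) : LeavittRel K G (vtx K (G.s e) * edge K e) (edge K e)
  | edge_range (e : E) : LeavittRel K G (edge K e * vtx K (G.r e)) (edge K e)
  | range_ghost (e : E) : LeavittRel K G (vtx K (G.r e) * ghost K e) (ghost K e)
  | ghost_source (e : E) : LeavittRel K G (ghost K e * vtx K (G.s e)) (ghost K e)
  | ck1_self (e : E) : LeavittRel K G (ghost K e * edge K e) (vtx K (G.r e))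
  | ck1_ne (e f : E) (h : e ≠ f) : LeavittRel K G (ghost K e * edge K f) 0
  | ck2 (a : V) (hn : {e : E | G.s e = a}.Nonempty) (hf : {e : E | G.s e = a}.Finite) :
      LeavittRel K G (vtx K a) (∑ e ∈ hf.toFinset, edge K e * ghost K e)
  | smul (k : K) (x y : LeavittFree K V E) :
      LeavittRel K G x y → LeavittRel K G (k • x) (k • y)

/-- The congruence on the free algebra generated by the defining relations. -/
noncomputable def leavittCon (K : Type w) [Field K] (G : DirectedGraph V E) : RingCon (LeavittFree K V E) :=
  ringConGen (G.LeavittRel K)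

theorem leavittCon_smul (K : Type w) [Field K] (G : DirectedGraph V E) (k : K)
    {x y : LeavittFree K V E} (h : G.leavittCon K x y) : G.leavittCon K (k • x) (k • y) := by
  change RingConGen.Rel _ _ _ at h
  change RingConGen.Rel _ _ _
  induction h with
  | of x y h => exact .of _ _ (.smul k x y h)
  | refl x => exact .refl _
  | symm _ ih => exact .symm ih
  | trans _ _ ih₁ ih₂ => exact .trans ih₁ ih₂
  | add _ _ ih₁ ih₂ => simpa only [smul_add] using RingConGen.Rel.add ih₁ ih₂
  | mul _ h₂ ih₁ _ => simpa only [smul_mul_assoc] using RingConGen.Rel.mul ih₁ h₂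

end DirectedGraph

/-- The Leavitt path algebra `L_K(G)`: the associative, not necessarily unital, `K`-algebra
generated by the vertices, edges and ghost edges of `G`, subject to the relations (V), (E1), (E2),
(CK1), (CK2). -/
def LeavittPathAlgebra (K : Type w) [Field K] {V : Type u} {E : Type v}
    (G : DirectedGraph V E) : Type (max u v w) :=
  (G.leavittCon K).Quotient

namespace LeavittPathAlgebra

variable (K : Type w) [Field K] {V : Type u} {E : Type v} (G : DirectedGraph V E)

noncomputable instance : NonUnitalRing (LeavittPathAlgebra K G) :=
  inferInstanceAs (NonUnitalRing (G.leavittCon K).Quotient)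

noncomputable instance : SMul K (LeavittPathAlgebra K G) where
  smul k := Quotient.map' (k • ·) fun _ _ h => G.leavittCon_smul K k h

/-- The quotient map from the free algebra. -/
noncomputable def mk (x : LeavittFree K V E) : LeavittPathAlgebra K G := (G.leavittCon K).toQuotient x

noncomputable instance : Module K (LeavittPathAlgebra K G) where
  one_smul x := by
    induction x using Quotient.inductionOn' with | _ x
    exact congrArg (mk K G) (one_smul K x)
  mul_smul a b x := by
    induction x using Quotient.inductionOn' with | _ x
    exact congrArg (mk K G) (mul_smul a b x)
  smul_zero a := congrArg (mk K G) (smul_zero a)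
  smul_add a x y := by
    induction x using Quotient.inductionOn' with | _ x
    induction y using Quotient.inductionOn' with | _ y
    exact congrArg (mk K G) (smul_add a x y)
  add_smul a b x := by
    induction x using Quotient.inductionOn' with | _ x
    exact congrArg (mk K G) (add_smul a b x)
  zero_smul x := by
    induction x using Quotient.inductionOn' with | _ x
    exact congrArg (mk K G) (zero_smul K x)

instance : IsScalarTower K (LeavittPathAlgebra K G) (LeavittPathAlgebra K G) where
  smul_assoc a x y := by
    induction x using Quotient.inductionOn' with | _ x
    induction y using Quotient.inductionOn' with | _ y
    exact congrArg (mk K G) (smul_mul_assoc a x y)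

instance : SMulCommClass K (LeavittPathAlgebra K G) (LeavittPathAlgebra K G) where
  smul_comm a x y := by
    induction x using Quotient.inductionOn' with | _ x
    induction y using Quotient.inductionOn' with | _ y
    exact congrArg (mk K G) (mul_smul_comm a x y).symm

end LeavittPathAlgebra

/-- A ring `R` is a commutator ring if `R = [R, R]`, where `[R, R]` is the additive subgroup
generated by the commutators `x * y - y * x`. -/
def IsCommutatorRing (R : Type u) [NonUnitalRing R] : Prop :=
  AddSubgroup.closure {z : R | ∃ x y : R, z = x * y - y * x} = ⊤

/-! A hereditary saturated set corresponds to the ideal generated by its vertices, and an ideal to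
the set of vertices it contains.

That an ideal I is generated by its vertices (`vtxIdeal_vertexSet`) is proved by induction on the
number of ghost edges. If x in I ends at a vertex that is not a sink, CK2, available by
row-finiteness, gives x = ∑ (x e) e*, and CK1 shows that each x e needs fewer ghost edges. What
remains is a linear combination of paths with a common range a. Acyclicity makes these orthogonal,
so multiplying by the ghost path p* of a path p that occurs leaves a non-zero multiple of a, and a
lies in I. That the ideal of H contains no further vertices (`vertexSet_vtxIdeal`) follows from a
representation in which exactly the vertices of H act as zero.

For commutator rings, the point is that every trace, i.e. additive τ with τ(xy) = τ(yx), vanishes.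
Modulo the relations other than CK2, a word is zero or a monomial p q*. Sending p q* to θ(g) if p =
q g with g closed, and to 0 otherwise, is a trace when θ is invariant under rotation, and it
respects CK2 when θ is harmonic on vertices (`exists_trace`). A cycle yields a non-zero trace
supported on the closed paths of its length; in an acyclic graph an infinite emitter yields one
supported on vertices (`Acyclic.exists_harmonic`). Hence the graph is acyclic and row-finite, and
the first statement applies. -/

namespace DirectedGraph

variable {V : Type u} {E : Type v} {G : DirectedGraph V E}

/-! ### Paths in acyclic graphs -/

theorem IsPath.append {a b c : V} {p q : List E} (hp : G.IsPath a p b) (hq : G.IsPath b q c) :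
    G.IsPath a (p ++ q) c := by
  induction p generalizing a with
  | nil => cases hp; exact hq
  | cons e p ih => exact ⟨hp.1, ih hp.2⟩

/-- The path is cut at its first visit to `c`. The last conjunct keeps `c` among the vertices of the
second piece, so when no vertex repeats, `c` is not a source in the first. -/
theorem IsPath.exists_split {a b c : V} {p : List E} (hp : G.IsPath a p b)
    (hc : c ∈ p.map G.s ++ [b]) :
    ∃ p₁ p₂, p = p₁ ++ p₂ ∧ G.IsPath a p₁ c ∧ c ∈ p₂.map G.s ++ [b] := by
  induction p generalizing a with
  | nil =>
    obtain rfl : c = b := by simpa using hc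
    exact ⟨[], [], rfl, hp, by simp⟩
  | cons e p ih =>
    by_cases h : c = a
    · subst h
      exact ⟨[], e :: p, rfl, rfl, hc⟩
    · have hc' : c ∈ p.map G.s ++ [b] := by
        have := hp.1
        simp only [List.map_cons, List.cons_append, List.mem_cons] at hc
        exact hc.resolve_left (this ▸ h)
      obtain ⟨p₁, p₂, rfl, h₁, h₂⟩ := ih hp.2 hc'
      exact ⟨e :: p₁, p₂, rfl, ⟨hp.1, h₁⟩, h₂⟩

/-- In an acyclic graph a path visits each vertex at most once. -/
theorem Acyclic.nodup_of_isPath (hG : G.Acyclic) {a b : V} {p : List E} (hp : G.IsPath a p b) :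
    (p.map G.s ++ [b]).Nodup := by
  induction p generalizing a with
  | nil => simp
  | cons e p ih =>
    have hnd := ih hp.2
    rw [List.map_cons, List.cons_append, List.nodup_cons]
    refine ⟨fun hmem => ?_, hnd⟩
    obtain ⟨p₁, p₂, rfl, h₁, h₂⟩ := hp.2.exists_split hmem
    rw [List.map_append, List.append_assoc] at hnd
    refine hG (e :: p₁) ⟨by simp, ⟨G.s e, rfl, h₁⟩, ?_⟩
    rw [List.map_cons, List.nodup_cons]
    exact ⟨fun h => List.disjoint_of_nodup_append hnd h h₂, hnd.of_append_left⟩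

theorem Acyclic.eq_nil_of_isPath (hG : G.Acyclic) {a : V} {p : List E} (hp : G.IsPath a p a) :
    p = [] := by
  cases p with
  | nil => rfl
  | cons e p =>
    have := hG.nodup_of_isPath hp
    simp [hp.1] at this

end DirectedGraph

/-! ### Relations, induction over words, and local units -/

namespace LeavittPathAlgebra

variable {K : Type w} [Field K] {V : Type u} {E : Type v} (G : DirectedGraph V E)

theorem mk_surjective : Function.Surjective (mk K G) := Quotient.mk''_surjective

theorem mk_mul (x y : LeavittFree K V E) : mk K G (x * y) = mk K G x * mk K G y := rfl

variable {G} in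
theorem mk_eq_mk {x y : LeavittFree K V E} (h : G.LeavittRel K x y) : mk K G x = mk K G y :=
  Quotient.sound' (RingConGen.Rel.of _ _ h)

variable (K)

/-- A vertex as an element of the Leavitt path algebra. -/
noncomputable def vtx (a : V) : LeavittPathAlgebra K G := mk K G (LeavittFree.vtx K a)

/-- An edge as an element of the Leavitt path algebra. -/
noncomputable def edge (e : E) : LeavittPathAlgebra K G := mk K G (LeavittFree.edge K e)

/-- A ghost edge as an element of the Leavitt path algebra. -/
noncomputable def ghost (e : E) : LeavittPathAlgebra K G := mk K G (LeavittFree.ghost K e)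

theorem vtx_mul_self (a : V) : vtx K G a * vtx K G a = vtx K G a :=
  mk_eq_mk (.vertex_self a)

theorem vtx_mul_vtx_of_ne {a b : V} (h : a ≠ b) : vtx K G a * vtx K G b = 0 :=
  mk_eq_mk (.vertex_ne a b h)

theorem vtx_mul_edge (e : E) : vtx K G (G.s e) * edge K G e = edge K G e :=
  mk_eq_mk (.source_edge e)

theorem edge_mul_vtx (e : E) : edge K G e * vtx K G (G.r e) = edge K G e :=
  mk_eq_mk (.edge_range e)

theorem vtx_mul_ghost (e : E) : vtx K G (G.r e) * ghost K G e = ghost K G e :=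
  mk_eq_mk (.range_ghost e)

theorem ghost_mul_vtx (e : E) : ghost K G e * vtx K G (G.s e) = ghost K G e :=
  mk_eq_mk (.ghost_source e)

theorem ghost_mul_edge_self (e : E) : ghost K G e * edge K G e = vtx K G (G.r e) :=
  mk_eq_mk (.ck1_self e)

theorem ghost_mul_edge_of_ne {e f : E} (h : e ≠ f) : ghost K G e * edge K G f = 0 :=
  mk_eq_mk (.ck1_ne e f h)

theorem vtx_eq_sum (a : V) (hn : {e : E | G.s e = a}.Nonempty) (hf : {e : E | G.s e = a}.Finite) :
    vtx K G a = ∑ e ∈ hf.toFinset, edge K G e * ghost K G e := by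
  refine (mk_eq_mk (.ck2 a hn hf)).trans ?_
  exact map_sum (⟨⟨mk K G, rfl⟩, fun _ _ => rfl⟩ : LeavittFree K V E →+ LeavittPathAlgebra K G) _ _

theorem ghost_mul_vtx_of_ne {e : E} {a : V} (h : G.s e ≠ a) : ghost K G e * vtx K G a = 0 := by
  rw [← ghost_mul_vtx, mul_assoc, vtx_mul_vtx_of_ne K G h, mul_zero]

theorem vtx_mul_edge_of_ne {e : E} {a : V} (h : a ≠ G.s e) : vtx K G a * edge K G e = 0 := by
  rw [← vtx_mul_edge, ← mul_assoc, vtx_mul_vtx_of_ne K G h, zero_mul]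

/-- The free algebra is spanned by the products of generators. -/
theorem free_induction {P : LeavittFree K V E → Prop} (zero : P 0)
    (add : ∀ x y, P x → P y → P (x + y)) (smul : ∀ (k : K) x, P x → P (k • x))
    (gen : ∀ g, P (LeavittFree.gen K g))
    (mul_gen : ∀ x g, P x → P (x * LeavittFree.gen K g)) (x : LeavittFree K V E) : P x := by
  -- `mul_gen` appends one generator on the right, whereas the recursion on words peels generators
  -- off the left; hence the arbitrary left factor `y`.
  have key : ∀ m : FreeSemigroup (LeavittGen V E), ∀ y, P y →
      P (y * MonoidAlgebra.single m 1) := by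
    intro m
    induction m using FreeSemigroup.recOnMul with
    | ih1 g => exact fun y hy => mul_gen y g hy
    | ih2 g m hg hm =>
      intro y hy
      have := hm _ (mul_gen y g hy)
      rwa [LeavittFree.gen, mul_assoc, MonoidAlgebra.single_mul_single, one_mul] at this
  have key' : ∀ m : FreeSemigroup (LeavittGen V E), P (MonoidAlgebra.single m 1) := by
    intro m
    induction m using FreeSemigroup.recOnMul with
    | ih1 g => exact gen g
    | ih2 g m hg hm =>
      have := key m _ (gen g)
      rwa [LeavittFree.gen, MonoidAlgebra.single_mul_single, one_mul] at this
  induction x using MonoidAlgebra.induction_linear with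
  | zero => exact zero
  | add x y hx hy => exact add x y hx hy
  | single m k =>
    have := smul k _ (key' m)
    rwa [MonoidAlgebra.smul_single, smul_eq_mul, mul_one] at this

variable {K G}

/-- The Leavitt path algebra is spanned by the products of generators. -/
theorem induction {P : LeavittPathAlgebra K G → Prop} (zero : P 0)
    (add : ∀ x y, P x → P y → P (x + y)) (smul : ∀ (k : K) x, P x → P (k • x))
    (vtx : ∀ a, P (vtx K G a)) (edge : ∀ e, P (edge K G e)) (ghost : ∀ e, P (ghost K G e))
    (mul_vtx : ∀ x a, P x → P (x * LeavittPathAlgebra.vtx K G a))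
    (mul_edge : ∀ x e, P x → P (x * LeavittPathAlgebra.edge K G e))
    (mul_ghost : ∀ x e, P x → P (x * LeavittPathAlgebra.ghost K G e))
    (x : LeavittPathAlgebra K G) : P x := by
  obtain ⟨x, rfl⟩ := mk_surjective G x
  refine free_induction (K := K) (P := fun x => P (mk K G x)) zero (fun x y => add _ _)
    (fun k x => smul k _) ?_ ?_ x
  · rintro (a | e | e)
    exacts [vtx a, edge e, ghost e]
  · rintro x (a | e | e) hx
    exacts [mul_vtx _ a hx, mul_edge _ e hx, mul_ghost _ e hx]

variable (K G) in
/-- The sum of the vertices in a finite set. -/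
noncomputable def vtxSum (F : Finset V) : LeavittPathAlgebra K G := ∑ a ∈ F, vtx K G a

open Classical in
theorem vtx_mul_vtxSum (a : V) (F : Finset V) :
    vtx K G a * vtxSum K G F = if a ∈ F then vtx K G a else 0 := by
  rw [vtxSum, Finset.mul_sum]
  split_ifs with h
  · rw [Finset.sum_eq_single_of_mem a h fun b _ hb => vtx_mul_vtx_of_ne K G hb.symm, vtx_mul_self]
  · exact Finset.sum_eq_zero fun b hb => vtx_mul_vtx_of_ne K G fun hab => h (hab ▸ hb)

open Classical in
theorem vtxSum_mul_vtxSum {F F' : Finset V} (h : F ⊆ F') :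
    vtxSum K G F * vtxSum K G F' = vtxSum K G F := by
  conv_lhs => rw [vtxSum, Finset.sum_mul]
  exact Finset.sum_congr rfl fun a ha => by rw [vtx_mul_vtxSum, if_pos (h ha)]

/-- The finite sums of vertices are right local units. -/
theorem exists_mul_vtxSum (x : LeavittPathAlgebra K G) : ∃ F, x * vtxSum K G F = x := by
  classical
  have step : ∀ (y g : LeavittPathAlgebra K G) (a : V), g * vtx K G a = g →
      y * g * vtxSum K G {a} = y * g := fun y g a h => by
    rw [vtxSum, Finset.sum_singleton, mul_assoc, h]
  have step' : ∀ (g : LeavittPathAlgebra K G) (a : V), g * vtx K G a = g →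
      g * vtxSum K G {a} = g := fun g a h => by
    rw [vtxSum, Finset.sum_singleton, h]
  induction x using induction with
  | zero => exact ⟨∅, zero_mul _⟩
  | add x y hx hy =>
    obtain ⟨F, hF⟩ := hx
    obtain ⟨F', hF'⟩ := hy
    refine ⟨F ∪ F', ?_⟩
    rw [add_mul]
    conv_lhs => rw [← hF, ← hF', mul_assoc, mul_assoc,
      vtxSum_mul_vtxSum Finset.subset_union_left, vtxSum_mul_vtxSum Finset.subset_union_right]
    rw [hF, hF']
  | smul k x hx =>
    obtain ⟨F, hF⟩ := hx
    exact ⟨F, by rw [smul_mul_assoc, hF]⟩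
  | vtx a => exact ⟨_, step' _ _ (vtx_mul_self K G a)⟩
  | edge e => exact ⟨_, step' _ _ (edge_mul_vtx K G e)⟩
  | ghost e => exact ⟨_, step' _ _ (ghost_mul_vtx K G e)⟩
  | mul_vtx x a => exact ⟨_, step _ _ _ (vtx_mul_self K G a)⟩
  | mul_edge x e => exact ⟨_, step _ _ _ (edge_mul_vtx K G e)⟩
  | mul_ghost x e => exact ⟨_, step _ _ _ (ghost_mul_vtx K G e)⟩

end LeavittPathAlgebra

/-! ### Paths, ghost paths and the filtration by ghost degree -/

namespace LeavittPathAlgebra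

variable (K : Type w) [Field K] {V : Type u} {E : Type v} (G : DirectedGraph V E)

/-- The element of the Leavitt path algebra given by the path `p` with source `a`. -/
noncomputable def path : V → List E → LeavittPathAlgebra K G
  | a, [] => vtx K G a
  | _, e :: p => edge K G e * path (G.r e) p

/-- The element of the Leavitt path algebra given by the ghost path of the path `p` with
source `a`. -/
noncomputable def ghostPath : V → List E → LeavittPathAlgebra K G
  | a, [] => vtx K G a
  | _, e :: p => ghostPath (G.r e) p * ghost K G e

theorem path_mul_edge {a b : V} {p : List E} (hp : G.IsPath a p b) {e : E} (he : G.s e = b) :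
    path K G a p * edge K G e = path K G a (p ++ [e]) := by
  induction p generalizing a with
  | nil =>
    cases hp
    simp only [path, List.nil_append]
    rw [edge_mul_vtx, ← he, vtx_mul_edge]
  | cons f p ih => simp only [path, List.cons_append, mul_assoc, ih hp.2]

theorem path_mul_vtx {a b : V} {p : List E} (hp : G.IsPath a p b) :
    path K G a p * vtx K G b = path K G a p := by
  induction p generalizing a with
  | nil => cases hp; exact vtx_mul_self K G _
  | cons f p ih => simp only [path, mul_assoc, ih hp.2]

theorem path_mul_vtx_of_ne {a b c : V} {p : List E} (hp : G.IsPath a p b) (h : b ≠ c) :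
    path K G a p * vtx K G c = 0 := by
  rw [← path_mul_vtx K G hp, mul_assoc, vtx_mul_vtx_of_ne K G h, mul_zero]

theorem path_mul_edge_of_ne {a b : V} {p : List E} (hp : G.IsPath a p b) {e : E}
    (he : b ≠ G.s e) : path K G a p * edge K G e = 0 := by
  rw [← path_mul_vtx K G hp, mul_assoc, vtx_mul_edge_of_ne K G he, mul_zero]

theorem vtx_mul_path {a b : V} {p : List E} (hp : G.IsPath a p b) :
    vtx K G a * path K G a p = path K G a p := by
  cases p with
  | nil => exact vtx_mul_self K G a
  | cons e p => simp only [path]; rw [← mul_assoc, ← hp.1, vtx_mul_edge]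

theorem vtx_mul_path_of_ne {a b c : V} {p : List E} (hp : G.IsPath a p b) (h : c ≠ a) :
    vtx K G c * path K G a p = 0 := by
  rw [← vtx_mul_path K G hp, ← mul_assoc, vtx_mul_vtx_of_ne K G h, zero_mul]

theorem ghostPath_mul_vtx {a b : V} {p : List E} (hp : G.IsPath a p b) :
    ghostPath K G a p * vtx K G a = ghostPath K G a p := by
  cases p with
  | nil => exact vtx_mul_self K G a
  | cons e p => simp only [ghostPath]; rw [mul_assoc, ← hp.1, ghost_mul_vtx]

theorem ghostPath_mul_vtx_of_ne {a b c : V} {p : List E} (hp : G.IsPath a p b) (h : a ≠ c) :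
    ghostPath K G a p * vtx K G c = 0 := by
  rw [← ghostPath_mul_vtx K G hp, mul_assoc, vtx_mul_vtx_of_ne K G h, mul_zero]

theorem ghostPath_mul_path_self {a b : V} {p : List E} (hp : G.IsPath a p b) :
    ghostPath K G a p * path K G a p = vtx K G b := by
  induction p generalizing a with
  | nil => cases hp; exact vtx_mul_self K G _
  | cons e p ih =>
    simp only [path, ghostPath]
    rw [mul_assoc, ← mul_assoc (ghost K G e), ghost_mul_edge_self, vtx_mul_path K G hp.2, ih hp.2]

/-- In an acyclic graph, different paths with the same range are orthogonal. -/
theorem ghostPath_mul_path_of_ne (hG : G.Acyclic) {a b c : V} {p q : List E}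
    (hp : G.IsPath a p c) (hq : G.IsPath b q c) (h : (a, p) ≠ (b, q)) :
    ghostPath K G a p * path K G b q = 0 := by
  induction p generalizing a b q with
  | nil =>
    cases hp
    refine vtx_mul_path_of_ne K G hq fun hab => h ?_
    subst hab
    rw [hG.eq_nil_of_isPath hq]
  | cons e p ih =>
    cases q with
    | nil =>
      cases hq
      refine ghostPath_mul_vtx_of_ne K G hp fun hab => h ?_
      subst hab
      rw [hG.eq_nil_of_isPath hp]
    | cons f q =>
      simp only [path, ghostPath]
      rw [mul_assoc, ← mul_assoc (ghost K G e)]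
      by_cases hef : e = f
      · subst hef
        rw [ghost_mul_edge_self, vtx_mul_path K G hq.2]
        refine ih hp.2 hq.2 fun hpq => h ?_
        rw [← hp.1, ← hq.1, (Prod.mk.inj hpq).2]
      · rw [ghost_mul_edge_of_ne K G hef, zero_mul, mul_zero]

/-- The span of the products of a path and at most `n` ghost edges. -/
noncomputable def ghostDegreeLE : ℕ → Submodule K (LeavittPathAlgebra K G)
  | 0 => Submodule.span K {x | ∃ a p b, G.IsPath a p b ∧ x = path K G a p}
  | n + 1 => ghostDegreeLE n ⊔ Submodule.span K {x | ∃ y ∈ ghostDegreeLE n, ∃ e, x = y * ghost K G e}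

variable {K G}

theorem ghostDegreeLE_le_succ (n : ℕ) : ghostDegreeLE K G n ≤ ghostDegreeLE K G (n + 1) :=
  le_sup_left

theorem path_mem_ghostDegreeLE {a b : V} {p : List E} (hp : G.IsPath a p b) :
    path K G a p ∈ ghostDegreeLE K G 0 :=
  Submodule.subset_span ⟨a, p, b, hp, rfl⟩

theorem mul_ghost_mem_ghostDegreeLE {n : ℕ} {x : LeavittPathAlgebra K G}
    (hx : x ∈ ghostDegreeLE K G n) (e : E) : x * ghost K G e ∈ ghostDegreeLE K G (n + 1) :=
  le_sup_right (a := ghostDegreeLE K G n) (Submodule.subset_span ⟨x, hx, e, rfl⟩)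

/-- To map `ghostDegreeLE K G 0` into a submodule by a right multiplication, it suffices to
consider paths. -/
theorem mul_mem_of_mem_ghostDegreeLE_zero {S : Submodule K (LeavittPathAlgebra K G)}
    {z x : LeavittPathAlgebra K G} (hx : x ∈ ghostDegreeLE K G 0)
    (h : ∀ a p b, G.IsPath a p b → path K G a p * z ∈ S) : x * z ∈ S := by
  have : ghostDegreeLE K G 0 ≤ S.comap (LinearMap.mulRight K z) := by
    refine Submodule.span_le.2 ?_
    rintro _ ⟨a, p, b, hp, rfl⟩
    exact h a p b hp
  exact this hx

theorem mul_mem_of_mem_ghostDegreeLE_succ {S : Submodule K (LeavittPathAlgebra K G)}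
    {z x : LeavittPathAlgebra K G} {n : ℕ} (hx : x ∈ ghostDegreeLE K G (n + 1))
    (h : ∀ y ∈ ghostDegreeLE K G n, y * z ∈ S)
    (h' : ∀ y ∈ ghostDegreeLE K G n, ∀ e, y * (ghost K G e * z) ∈ S) : x * z ∈ S := by
  have : ghostDegreeLE K G (n + 1) ≤ S.comap (LinearMap.mulRight K z) := by
    refine sup_le h (Submodule.span_le.2 ?_)
    rintro _ ⟨y, hy, e, rfl⟩
    simpa [mul_assoc] using h' y hy e
  exact this hx

theorem mul_vtx_mem_ghostDegreeLE {n : ℕ} {x : LeavittPathAlgebra K G}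
    (hx : x ∈ ghostDegreeLE K G n) (a : V) : x * vtx K G a ∈ ghostDegreeLE K G n := by
  induction n generalizing x with
  | zero =>
    refine mul_mem_of_mem_ghostDegreeLE_zero hx fun b p c hp => ?_
    by_cases h : c = a
    · subst h
      rw [path_mul_vtx K G hp]
      exact path_mem_ghostDegreeLE hp
    · rw [path_mul_vtx_of_ne K G hp h]
      exact zero_mem _
  | succ n ih =>
    refine mul_mem_of_mem_ghostDegreeLE_succ hx (fun y hy => ghostDegreeLE_le_succ n (ih hy))
      fun y hy e => ?_
    by_cases h : G.s e = a
    · subst h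
      rw [ghost_mul_vtx]
      exact mul_ghost_mem_ghostDegreeLE hy e
    · rw [ghost_mul_vtx_of_ne K G h, mul_zero]
      exact zero_mem _

theorem mul_edge_mem_ghostDegreeLE_zero {x : LeavittPathAlgebra K G}
    (hx : x ∈ ghostDegreeLE K G 0) (e : E) : x * edge K G e ∈ ghostDegreeLE K G 0 := by
  refine mul_mem_of_mem_ghostDegreeLE_zero hx fun a p b hp => ?_
  by_cases h : b = G.s e
  · rw [path_mul_edge K G hp h.symm]
    exact path_mem_ghostDegreeLE (hp.append (q := [e]) ⟨h.symm, rfl⟩)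
  · rw [path_mul_edge_of_ne K G hp h]
    exact zero_mem _

/-- By CK1, the edge either cancels the last ghost edge, up to a vertex, or kills the product. In
degree 0 there is nothing to cancel and the degree stays 0, which is why `key` takes stability of
degree `n` as a hypothesis. -/
theorem mul_edge_mem_ghostDegreeLE {n : ℕ} {x : LeavittPathAlgebra K G}
    (hx : x ∈ ghostDegreeLE K G (n + 1)) (e : E) : x * edge K G e ∈ ghostDegreeLE K G n := by
  have key : ∀ n, (∀ y ∈ ghostDegreeLE K G n, y * edge K G e ∈ ghostDegreeLE K G n) →
      ∀ x ∈ ghostDegreeLE K G (n + 1), x * edge K G e ∈ ghostDegreeLE K G n := by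
    intro n hn x hx
    refine mul_mem_of_mem_ghostDegreeLE_succ hx hn fun y hy f => ?_
    by_cases h : f = e
    · subst h
      rw [ghost_mul_edge_self]
      exact mul_vtx_mem_ghostDegreeLE hy _
    · rw [ghost_mul_edge_of_ne K G h, mul_zero]
      exact zero_mem _
  have key' : ∀ n, ∀ y ∈ ghostDegreeLE K G n, y * edge K G e ∈ ghostDegreeLE K G n := by
    intro n
    induction n with
    | zero => exact fun y hy => mul_edge_mem_ghostDegreeLE_zero hy e
    | succ n ih => exact fun y hy => ghostDegreeLE_le_succ n (key n ih y hy)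
  exact key n (key' n) x hx

theorem exists_mem_ghostDegreeLE (x : LeavittPathAlgebra K G) :
    ∃ n, x ∈ ghostDegreeLE K G n := by
  have mono : Monotone (ghostDegreeLE K G) := monotone_nat_of_le_succ ghostDegreeLE_le_succ
  have hv : ∀ a, vtx K G a ∈ ghostDegreeLE K G 0 := fun a =>
    path_mem_ghostDegreeLE (p := []) (rfl : a = a)
  induction x using induction with
  | zero => exact ⟨0, zero_mem _⟩
  | add x y hx hy =>
    obtain ⟨m, hm⟩ := hx
    obtain ⟨n, hn⟩ := hy
    exact ⟨max m n, add_mem (mono (le_max_left m n) hm) (mono (le_max_right m n) hn)⟩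
  | smul k x hx => exact hx.imp fun n => Submodule.smul_mem _ k
  | vtx a => exact ⟨0, hv a⟩
  | edge e =>
    exact ⟨0, vtx_mul_edge K G e ▸ mul_edge_mem_ghostDegreeLE_zero (hv _) e⟩
  | ghost e => exact ⟨1, vtx_mul_ghost K G e ▸ mul_ghost_mem_ghostDegreeLE (hv _) e⟩
  | mul_vtx x a hx => exact hx.imp fun n hn => mul_vtx_mem_ghostDegreeLE hn a
  | mul_edge x e hx =>
    exact hx.imp fun n hn => mul_edge_mem_ghostDegreeLE (ghostDegreeLE_le_succ n hn) e
  | mul_ghost x e hx => exact hx.elim fun n hn => ⟨n + 1, mul_ghost_mem_ghostDegreeLE hn e⟩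

theorem vtx_mem_of_smul_mem {I : TwoSidedIdeal (LeavittPathAlgebra K G)} {k : K} (hk : k ≠ 0)
    {a : V} (h : k • vtx K G a ∈ I) : vtx K G a ∈ I := by
  have := I.mul_mem_left (k⁻¹ • vtx K G a) _ h
  rwa [smul_mul_smul_comm, inv_mul_cancel₀ hk, one_smul, vtx_mul_self] at this

/-- In an acyclic graph, an ideal that contains a non-zero linear combination of paths with the
same range contains that range. -/
theorem vtx_mem_of_mem_ghostDegreeLE_zero (hG : G.Acyclic)
    {I : TwoSidedIdeal (LeavittPathAlgebra K G)} {x : LeavittPathAlgebra K G} {a : V}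
    (hx : x ∈ ghostDegreeLE K G 0) (hxa : x * vtx K G a = x) (hI : x ∈ I) (h0 : x ≠ 0) :
    vtx K G a ∈ I := by
  have hspan : x ∈ Submodule.span K (Set.range
      fun i : {i : V × List E // G.IsPath i.1 i.2 a} => path K G i.1.1 i.1.2) := by
    rw [← hxa]
    refine mul_mem_of_mem_ghostDegreeLE_zero hx fun b p c hp => ?_
    by_cases h : c = a
    · subst h
      rw [path_mul_vtx K G hp]
      exact Submodule.subset_span ⟨⟨(b, p), hp⟩, rfl⟩
    · rw [path_mul_vtx_of_ne K G hp h]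
      exact zero_mem _
  obtain ⟨c, rfl⟩ := Finsupp.mem_span_range_iff_exists_finsupp.1 hspan
  have hc : c ≠ 0 := by
    rintro rfl
    exact h0 Finsupp.sum_zero_index
  obtain ⟨i, hi⟩ := Finsupp.ne_iff.1 hc
  refine vtx_mem_of_smul_mem (k := c i) hi ?_
  -- By orthogonality, left multiplication by this ghost path kills every term but the `i`-th and
  -- turns that one into `c i` times the vertex `a`.
  convert I.mul_mem_left (ghostPath K G i.1.1 i.1.2) _ hI using 1
  rw [Finsupp.sum, Finset.mul_sum, Finset.sum_eq_single_of_mem i (Finsupp.mem_support_iff.2 hi),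
    mul_smul_comm, ghostPath_mul_path_self K G i.2]
  intro j _ hj
  rw [mul_smul_comm, ghostPath_mul_path_of_ne K G hG i.2 j.2
    (fun h => hj (Subtype.ext h).symm), smul_zero]

/-! ### Ideals and the vertices they contain -/

variable (K G)

/-- The ideal generated by a set of vertices. -/
noncomputable def vtxIdeal (H : Set V) : TwoSidedIdeal (LeavittPathAlgebra K G) :=
  TwoSidedIdeal.span (vtx K G '' H)

variable {K G}

/-- The set of the vertices in an ideal. -/
def vertexSet (I : TwoSidedIdeal (LeavittPathAlgebra K G)) : Set V := {a | vtx K G a ∈ I}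

theorem vtx_mem_vtxIdeal {H : Set V} {a : V} (h : a ∈ H) : vtx K G a ∈ vtxIdeal K G H :=
  TwoSidedIdeal.subset_span ⟨a, h, rfl⟩

theorem mem_vtxIdeal_of_mem_ghostDegreeLE (hG : G.Acyclic) (hR : G.RowFinite)
    {I : TwoSidedIdeal (LeavittPathAlgebra K G)} {n : ℕ} {x : LeavittPathAlgebra K G} {a : V}
    (hx : x ∈ ghostDegreeLE K G n) (hxa : x * vtx K G a = x) (hI : x ∈ I) :
    x ∈ vtxIdeal K G (vertexSet I) := by
  induction n generalizing x a with
  | zero =>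
    by_cases h0 : x = 0
    · rw [h0]
      exact zero_mem _
    · rw [← hxa]
      exact TwoSidedIdeal.mul_mem_left _ _ _
        (vtx_mem_vtxIdeal (vtx_mem_of_mem_ghostDegreeLE_zero hG hx hxa hI h0))
  | succ n ih =>
    by_cases hn : {e : E | G.s e = a}.Nonempty
    -- CK2 at `a` writes x as the sum of the (x e) e*, and each x e lies in `I`, ends at r(e) and
    -- has smaller ghost degree.
    · rw [← hxa, vtx_eq_sum K G a hn (hR a), Finset.mul_sum]
      refine sum_mem fun e _ => ?_
      rw [← mul_assoc]
      refine TwoSidedIdeal.mul_mem_right _ _ _ (ih (a := G.r e) (mul_edge_mem_ghostDegreeLE hx e) ?_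
        (I.mul_mem_right _ _ hI))
      rw [mul_assoc, edge_mul_vtx]
    -- At a sink `a` every e* a vanishes, so multiplying by `a` removes the terms of top ghost
    -- degree.
    · refine ih ?_ hxa hI
      rw [← hxa]
      refine mul_mem_of_mem_ghostDegreeLE_succ hx (fun y hy => mul_vtx_mem_ghostDegreeLE hy a)
        fun y hy e => ?_
      rw [ghost_mul_vtx_of_ne K G (fun h => hn ⟨e, h⟩), mul_zero]
      exact zero_mem _

/-- Over an acyclic row-finite graph, each ideal is generated by the vertices that it contains. -/
theorem vtxIdeal_vertexSet (hG : G.Acyclic) (hR : G.RowFinite)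
    (I : TwoSidedIdeal (LeavittPathAlgebra K G)) : vtxIdeal K G (vertexSet I) = I := by
  refine le_antisymm (TwoSidedIdeal.span_le.2 ?_) fun x hx => ?_
  · rintro _ ⟨a, ha, rfl⟩
    exact ha
  · obtain ⟨n, hn⟩ := exists_mem_ghostDegreeLE x
    obtain ⟨F, hF⟩ := exists_mul_vtxSum x
    rw [← hF, vtxSum, Finset.mul_sum]
    refine sum_mem fun a _ => ?_
    exact mem_vtxIdeal_of_mem_ghostDegreeLE hG hR (a := a) (mul_vtx_mem_ghostDegreeLE hn a)
      (by rw [mul_assoc, vtx_mul_self]) (I.mul_mem_right _ _ hx)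

/-- For a path p from a to b, b = p* p = p* a p. -/
theorem hereditary_vertexSet (I : TwoSidedIdeal (LeavittPathAlgebra K G)) :
    G.Hereditary (vertexSet I) := by
  rintro a b ha ⟨p, hp⟩
  change vtx K G b ∈ I
  rw [← ghostPath_mul_path_self K G hp, ← vtx_mul_path K G hp]
  exact I.mul_mem_left _ _ (I.mul_mem_right _ _ ha)

/-- CK2 gives a = ∑ e e* = ∑ e r(e) e*. -/
theorem saturated_vertexSet (I : TwoSidedIdeal (LeavittPathAlgebra K G)) :
    G.Saturated (vertexSet I) := by
  intro a hn hf h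
  change vtx K G a ∈ I
  rw [vtx_eq_sum K G a hn hf]
  refine sum_mem fun e he => ?_
  rw [← edge_mul_vtx]
  exact I.mul_mem_right _ _ (I.mul_mem_left _ _ (h e (by simpa using he)))

end LeavittPathAlgebra

/-! ### A representation that detects the vertices outside a hereditary saturated set -/

namespace LeavittPathAlgebra

section Lift

variable {K : Type w} [Field K] {V : Type u} {E : Type v} {G : DirectedGraph V E}

/-- A family of elements of an algebra that satisfies the relations of the Leavitt path algebra
defines a homomorphism. -/
theorem exists_hom {A : Type*} [Ring A] [Algebra K A] (ρ : LeavittGen V E → A)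
    (vertex_self : ∀ a, ρ (.vertex a) * ρ (.vertex a) = ρ (.vertex a))
    (vertex_ne : ∀ a b, a ≠ b → ρ (.vertex a) * ρ (.vertex b) = 0)
    (source_edge : ∀ e, ρ (.vertex (G.s e)) * ρ (.edge e) = ρ (.edge e))
    (edge_range : ∀ e, ρ (.edge e) * ρ (.vertex (G.r e)) = ρ (.edge e))
    (range_ghost : ∀ e, ρ (.vertex (G.r e)) * ρ (.ghost e) = ρ (.ghost e))
    (ghost_source : ∀ e, ρ (.ghost e) * ρ (.vertex (G.s e)) = ρ (.ghost e))
    (ck1_self : ∀ e, ρ (.ghost e) * ρ (.edge e) = ρ (.vertex (G.r e)))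
    (ck1_ne : ∀ e f, e ≠ f → ρ (.ghost e) * ρ (.edge f) = 0)
    (ck2 : ∀ (a : V) (_ : {e : E | G.s e = a}.Nonempty) (hf : {e : E | G.s e = a}.Finite),
      ρ (.vertex a) = ∑ e ∈ hf.toFinset, ρ (.edge e) * ρ (.ghost e)) :
    ∃ φ : LeavittPathAlgebra K G →ₙ+* A, ∀ a, φ (vtx K G a) = ρ (.vertex a) := by
  let ψ : LeavittFree K V E →ₙₐ[K] A := MonoidAlgebra.liftMagma K (FreeSemigroup.lift ρ)
  have hψ : ∀ g, ψ (LeavittFree.gen K g) = ρ g := fun g => by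
    simp [ψ, LeavittFree.gen, MonoidAlgebra.liftMagma_apply_apply]
  have hle : ∀ x y, G.leavittCon K x y → ψ x = ψ y := by
    intro x y hxy
    have : G.leavittCon K ≤ (TwoSidedIdeal.ker ψ).ringCon := by
      refine RingCon.ringConGen_le.2 fun x y h => ?_
      rw [TwoSidedIdeal.ker_ringCon]
      induction h with
      | smul k x y _ ih => rw [map_smul, map_smul, ih]
      | ck2 a hn hf =>
        simp only [map_sum, map_mul, LeavittFree.vtx, LeavittFree.edge, LeavittFree.ghost, hψ]
        exact ck2 a hn hf
      | _ =>
        simp only [map_zero, map_mul, LeavittFree.vtx, LeavittFree.edge, LeavittFree.ghost,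
          *, ne_eq, not_false_eq_true]
    exact (TwoSidedIdeal.ker_ringCon ψ).1 (this hxy)
  refine ⟨{ toFun := Quotient.lift ψ hle, map_zero' := map_zero ψ, map_add' := ?_,
            map_mul' := ?_ }, fun a => hψ _⟩
  · intro x y
    obtain ⟨x, rfl⟩ := mk_surjective G x
    obtain ⟨y, rfl⟩ := mk_surjective G y
    exact map_mul ψ x y
  · intro x y
    obtain ⟨x, rfl⟩ := mk_surjective G x
    obtain ⟨y, rfl⟩ := mk_surjective G y
    exact map_add ψ x y

end Lift

section Branching

variable {V : Type u} {E : Type v} (G : DirectedGraph V E) (H : Set V)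

/-- For a hereditary saturated set `H` of a row-finite graph, the copies of `ℕ` at the vertices
outside `H` can be matched with one another along the edges. -/
theorem exists_branching (hR : G.RowFinite) (hS : G.Saturated H) :
    ∃ σ : E → ℕ → ℕ,
      (∀ e f m n, G.r e ∉ H → G.r f ∉ H → G.s e = G.s f → σ e m = σ f n → e = f ∧ m = n) ∧
      (∀ a, a ∉ H → {e : E | G.s e = a}.Nonempty → ∀ n, ∃ e m,
        G.s e = a ∧ G.r e ∉ H ∧ σ e m = n) := by
  classical
  have key : ∀ a : V, ∃ τ : {e : E // G.s e = a ∧ G.r e ∉ H} × ℕ → ℕ, Function.Injective τ ∧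
      (a ∉ H → {e : E | G.s e = a}.Nonempty → Function.Surjective τ) := by
    intro a
    have hfin : Finite {e : E // G.s e = a ∧ G.r e ∉ H} :=
      ((hR a).subset fun e he => he.1).to_subtype
    by_cases hne : Nonempty {e : E // G.s e = a ∧ G.r e ∉ H}
    · have : Infinite ({e : E // G.s e = a ∧ G.r e ∉ H} × ℕ) := Prod.infinite_of_right
      obtain ⟨τ⟩ := nonempty_equiv_of_countable
        (α := {e : E // G.s e = a ∧ G.r e ∉ H} × ℕ) (β := ℕ)
      exact ⟨τ, τ.injective, fun _ _ => τ.surjective⟩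
    -- Here the domain of τ is empty, so injectivity is vacuous; saturation rules out a non-sink `a`
    -- outside `H`.
    · refine ⟨fun _ => 0, fun x => (hne ⟨x.1⟩).elim, fun ha hn => (ha ?_).elim⟩
      refine hS a hn (hR a) fun e he => ?_
      by_contra h
      exact hne ⟨⟨e, he, h⟩⟩
  choose τ hinj hsurj using key
  refine ⟨fun e m => if h : G.r e ∉ H then τ (G.s e) (⟨e, rfl, h⟩, m) else 0, ?_, ?_⟩
  · intro e f m n he hf hs h
    have aux : ∀ (a : V) (hfa : G.s f = a),
        τ (G.s f) (⟨f, rfl, hf⟩, n) = τ a (⟨f, hfa, hf⟩, n) := by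
      rintro _ rfl
      rfl
    simp only [dif_pos he, dif_pos hf] at h
    simpa using hinj _ (h.trans (aux _ hs.symm))
  · intro a ha hn n
    obtain ⟨⟨⟨e, rfl, he⟩, m⟩, rfl⟩ := hsurj a ha hn n
    exact ⟨e, m, rfl, he, dif_pos he⟩

end Branching

variable {K : Type w} [Field K] {V : Type u} {E : Type v} {G : DirectedGraph V E}

set_option maxHeartbeats 2000000 in
/-- In a row-finite graph, the ideal generated by a hereditary saturated set contains no other
vertex. -/
theorem vertexSet_vtxIdeal (hR : G.RowFinite) {H : Set V} (hH : G.Hereditary H)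
    (hS : G.Saturated H) : vertexSet (vtxIdeal K G H) = H := by
  classical
  refine Set.Subset.antisymm (fun a ha => ?_) fun a ha => vtx_mem_vtxIdeal ha
  by_contra haH
  obtain ⟨σ, hinj, hsurj⟩ := exists_branching G H hR hS
  have hsH : ∀ e, G.r e ∉ H → G.s e ∉ H := fun e he h => he (hH _ _ h ⟨[e], rfl, rfl⟩)
  -- Each vertex outside `H` carries a copy of `ℕ`. `P a` restricts functions to the copy at `a`; `S
  -- e` transports them from the copy at r(e) into the copy at s(e) along `σ e`, and `T e` pulls
  -- them back. All three vanish when `a`, respectively r(e), is in `H`. Injectivity of σ gives CK1,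
  -- its surjectivity CK2.
  let P : V → Module.End K (V × ℕ → K) := fun a =>
    { toFun := fun f x => if x.1 = a ∧ a ∉ H then f x else 0
      map_add' := fun f g => by ext x; simp only [Pi.add_apply]; split_ifs <;> simp
      map_smul' := fun k f => by ext x; simp }
  let S : E → Module.End K (V × ℕ → K) := fun e =>
    { toFun := fun f x => if h : G.r e ∉ H ∧ x.1 = G.s e ∧ ∃ m, σ e m = x.2
        then f (G.r e, h.2.2.choose) else 0
      map_add' := fun f g => by ext x; simp only [Pi.add_apply]; split_ifs <;> simp
      map_smul' := fun k f => by ext x; simp }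
  let T : E → Module.End K (V × ℕ → K) := fun e =>
    { toFun := fun f x => if G.r e ∉ H ∧ x.1 = G.r e then f (G.s e, σ e x.2) else 0
      map_add' := fun f g => by ext x; simp only [Pi.add_apply]; split_ifs <;> simp
      map_smul' := fun k f => by ext x; simp }
  have hP : ∀ a f x, P a f x = if x.1 = a ∧ a ∉ H then f x else 0 := fun _ _ _ => rfl
  have hT : ∀ e f x, T e f x = if G.r e ∉ H ∧ x.1 = G.r e then f (G.s e, σ e x.2) else 0 :=
    fun _ _ _ => rfl
  have hS₁ : ∀ e f m, G.r e ∉ H → S e f (G.s e, σ e m) = f (G.r e, m) := by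
    intro e f m he
    have h : G.r e ∉ H ∧ G.s e = G.s e ∧ ∃ m', σ e m' = σ e m := ⟨he, rfl, m, rfl⟩
    change (if h : G.r e ∉ H ∧ G.s e = G.s e ∧ ∃ m', σ e m' = σ e m
        then f (G.r e, h.2.2.choose) else 0) = _
    rw [dif_pos h, (hinj e e _ _ he he rfl h.2.2.choose_spec).2]
  have hS₀ : ∀ e f x, (∀ m, G.r e ∉ H → x ≠ (G.s e, σ e m)) → S e f x = 0 := by
    intro e f x h
    refine dif_neg ?_
    rintro ⟨he, hx, m, hm⟩
    exact h m he (Prod.ext hx hm.symm)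
  have hSx : ∀ e x, (∃ m, G.r e ∉ H ∧ x = (G.s e, σ e m)) ∨
      ∀ m, G.r e ∉ H → x ≠ (G.s e, σ e m) := by
    intro e x
    by_cases h : ∃ m, G.r e ∉ H ∧ x = (G.s e, σ e m)
    · exact .inl h
    · exact .inr fun m he hx => h ⟨m, he, hx⟩
  let ρ : LeavittGen V E → Module.End K (V × ℕ → K)
    | .vertex a => P a
    | .edge e => S e
    | .ghost e => T e
  obtain ⟨φ, hφ⟩ := exists_hom (K := K) (G := G) ρ
    (by
      intro a
      refine LinearMap.ext fun f => funext fun x => ?_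
      simp only [ρ, Module.End.mul_apply, hP]
      split_ifs <;> rfl)
    (by
      intro a b hab
      refine LinearMap.ext fun f => funext fun x => ?_
      simp only [ρ, Module.End.mul_apply, hP, LinearMap.zero_apply, Pi.zero_apply]
      split_ifs with h h'
      · exact absurd (h.1.symm.trans h'.1) hab
      · rfl
      · rfl)
    (by
      intro e
      refine LinearMap.ext fun f => funext fun x => ?_
      simp only [ρ, Module.End.mul_apply, hP]
      rcases hSx e x with ⟨m, he, rfl⟩ | h
      · rw [if_pos ⟨rfl, hsH e he⟩]
      · rw [hS₀ e f x h, ite_self])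
    (by
      intro e
      refine LinearMap.ext fun f => funext fun x => ?_
      simp only [ρ, Module.End.mul_apply]
      rcases hSx e x with ⟨m, he, rfl⟩ | h
      · rw [hS₁ e _ m he, hS₁ e _ m he, hP, if_pos ⟨rfl, he⟩]
      · rw [hS₀ e _ x h, hS₀ e _ x h])
    (by
      intro e
      refine LinearMap.ext fun f => funext fun x => ?_
      simp only [ρ, Module.End.mul_apply, hP, hT]
      split_ifs <;> simp_all)
    (by
      intro e
      refine LinearMap.ext fun f => funext fun x => ?_
      simp only [ρ, Module.End.mul_apply, hP, hT]
      split_ifs <;> simp_all)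
    (by
      intro e
      refine LinearMap.ext fun f => funext fun x => ?_
      simp only [ρ, Module.End.mul_apply, hP, hT]
      by_cases h : G.r e ∉ H ∧ x.1 = G.r e
      · rw [if_pos h, if_pos h.symm, hS₁ e _ _ h.1, ← h.2]
      · rw [if_neg h, if_neg fun h' => h h'.symm])
    (by
      intro e f hef
      refine LinearMap.ext fun g => funext fun x => ?_
      simp only [ρ, Module.End.mul_apply, hT]
      split_ifs with h
      · refine hS₀ f g _ fun m hf hx => hef ?_
        exact (hinj e f _ m h.1 hf (Prod.mk.inj hx).1 (Prod.mk.inj hx).2).1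
      · rfl)
    (by
      intro a hn hf
      refine LinearMap.ext fun f => funext fun x => ?_
      simp only [ρ, LinearMap.sum_apply, Finset.sum_apply, Module.End.mul_apply, hP]
      by_cases h : x.1 = a ∧ a ∉ H
      · obtain ⟨e, m, he, her, hm⟩ := hsurj a h.2 hn x.2
        have hx : x = (G.s e, σ e m) := Prod.ext (h.1.trans he.symm) hm.symm
        rw [if_pos h, Finset.sum_eq_single_of_mem e (by simpa using he), hx, hS₁ e _ m her, hT,
          if_pos ⟨her, rfl⟩]
        intro e' he' hne
        refine hS₀ _ _ _ fun m' her' hx' => hne ?_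
        rw [hx] at hx'
        exact (hinj e e' m m' her her' (Prod.mk.inj hx').1 (Prod.mk.inj hx').2).1.symm
      · rw [if_neg h]
        refine (Finset.sum_eq_zero fun e he => hS₀ _ _ _ fun m her hx => h ?_).symm
        have he : G.s e = a := by simpa using he
        exact ⟨hx ▸ he, he ▸ hsH e her⟩)
  have hker : vtxIdeal K G H ≤ TwoSidedIdeal.ker φ := by
    refine TwoSidedIdeal.span_le.2 ?_
    rintro _ ⟨b, hb, rfl⟩
    rw [SetLike.mem_coe, TwoSidedIdeal.mem_ker, hφ]
    refine LinearMap.ext fun f => funext fun x => ?_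
    exact if_neg fun h => h.2 hb
  have h0 : P a = 0 := (hφ a).symm.trans ((TwoSidedIdeal.mem_ker φ).1 (hker ha))
  -- The constant function 1 shows that a vertex outside `H` acts non-trivially.
  have h1 : P a 1 (a, 0) = 1 := if_pos ⟨rfl, haH⟩
  rw [h0] at h1
  exact zero_ne_one h1

/-- The ideals of the Leavitt path algebra of an acyclic row-finite graph correspond to the
hereditary saturated sets of vertices. -/
noncomputable def hereditarySaturatedOrderIso (hG : G.Acyclic) (hR : G.RowFinite) :
    G.HereditarySaturated ≃o TwoSidedIdeal (LeavittPathAlgebra K G) where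
  toFun H := vtxIdeal K G H.1
  invFun I := ⟨vertexSet I, hereditary_vertexSet I, saturated_vertexSet I⟩
  left_inv H := Subtype.ext (vertexSet_vtxIdeal hR H.2.1 H.2.2)
  right_inv I := vtxIdeal_vertexSet hG hR I
  map_rel_iff' {H H'} := by
    refine ⟨fun h a ha => ?_, fun h => TwoSidedIdeal.span_mono (Set.image_mono h)⟩
    rw [← vertexSet_vtxIdeal (K := K) hR H'.2.1 H'.2.2]
    exact h (vtx_mem_vtxIdeal ha)

end LeavittPathAlgebra

/-! ### Monomials p q* and the trace of a word -/

namespace DirectedGraph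

variable {V : Type u} {E : Type v} (G : DirectedGraph V E)

/-- The source of the path `p` with range `b`. -/
def src : List E → V → V
  | [], b => b
  | e :: _, _ => G.s e

open Classical in
/-- Left multiplication of `p q*`, where the paths `p` and `q` have range `b`, by a generator. -/
noncomputable def leftStep : LeavittGen V E → List E × V × List E → Option (List E × V × List E)
  | .vertex a, (p, b, q) => if G.src p b = a then some (p, b, q) else none
  | .edge e, (p, b, q) => if G.src p b = G.r e then some (e :: p, b, q) else none
  | .ghost e, (f :: p, b, q) => if e = f ∧ G.src p b = G.r e then some (p, b, q) else none
  | .ghost e, ([], b, q) => if G.s e = b then some ([], G.r e, q ++ [e]) else none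

open Classical in
/-- Right multiplication of `p q*`, where the paths `p` and `q` have range `b`, by a generator. -/
noncomputable def rightStep : LeavittGen V E → List E × V × List E → Option (List E × V × List E)
  | .vertex a, (p, b, q) => if G.src q b = a then some (p, b, q) else none
  | .ghost e, (p, b, q) => if G.src q b = G.r e then some (p, b, e :: q) else none
  | .edge e, (p, b, f :: q) => if e = f ∧ G.src q b = G.r e then some (p, b, q) else none
  | .edge e, (p, b, []) => if G.s e = b then some (p ++ [e], G.r e, []) else none

/-- The normal form of a generator. -/
def genNormalForm : LeavittGen V E → List E × V × List E
  | .vertex a => ([], a, [])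
  | .edge e => ([e], G.r e, [])
  | .ghost e => ([], G.r e, [e])

/-- The normal form `p q*` of a product of generators; it is `none` if the product is zero. -/
noncomputable def normalForm : List (LeavittGen V E) → Option (List E × V × List E)
  | [] => none
  | [g] => some (G.genNormalForm g)
  | g :: h :: l => (normalForm (h :: l)).bind (G.leftStep g)

@[simp]
theorem src_nil (b : V) : G.src [] b = b := rfl

@[simp]
theorem src_cons (e : E) (p : List E) (b : V) : G.src (e :: p) b = G.s e := rfl

@[simp]
theorem src_append_singleton (p : List E) (e : E) (b : V) :
    G.src (p ++ [e]) b = G.src p (G.s e) := by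
  cases p <;> rfl

/-- This is associativity, (g x) h = g (x h), at the level of monomials; it lets a word be evaluated
from either end. -/
theorem rightStep_bind_leftStep (g h : LeavittGen V E) (x : List E × V × List E) :
    (G.rightStep h x).bind (G.leftStep g) = (G.leftStep g x).bind (G.rightStep h) := by
  obtain ⟨p, b, q⟩ := x
  rcases g with a | e | e <;> rcases h with c | f | f <;> rcases p with _ | ⟨e', p⟩ <;>
    rcases q with _ | ⟨f', q⟩ <;> simp only [leftStep, rightStep] <;> split_ifs <;>
    simp only [Option.bind_some, Option.bind_none, leftStep, rightStep, src_nil, src_cons,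
      src_append_singleton, List.cons_append, List.nil_append] at * <;>
    (try split_ifs) <;> simp_all
  grind

theorem leftStep_genNormalForm (g h : LeavittGen V E) :
    G.leftStep g (G.genNormalForm h) = G.rightStep h (G.genNormalForm g) := by
  rcases g with a | e | e <;> rcases h with c | f | f <;>
    simp only [leftStep, rightStep, genNormalForm, src_nil, src_cons, List.nil_append] <;>
    grind

theorem normalForm_cons (g : LeavittGen V E) {l : List (LeavittGen V E)} (hl : l ≠ []) :
    G.normalForm (g :: l) = (G.normalForm l).bind (G.leftStep g) := by
  cases l with
  | nil => exact absurd rfl hl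
  | cons h l => rfl

theorem normalForm_concat (g : LeavittGen V E) {l : List (LeavittGen V E)} (hl : l ≠ []) :
    G.normalForm (l ++ [g]) = (G.normalForm l).bind (G.rightStep g) := by
  induction l with
  | nil => exact absurd rfl hl
  | cons h l ih =>
    cases l with
    | nil => exact G.leftStep_genNormalForm h g
    | cons k l =>
      rw [List.cons_append, normalForm_cons G h (by simp), ih (by simp),
        normalForm_cons G h (List.cons_ne_nil k l), Option.bind_assoc, Option.bind_assoc]
      simp only [rightStep_bind_leftStep]

/-- Needed for CK2: after e* has removed the first edge e, multiplying by e restores it only if the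
remaining path starts at r(e). -/
theorem isPath_of_normalForm {l : List (LeavittGen V E)} {p q : List E} {b : V}
    (h : G.normalForm l = some (p, b, q)) : G.IsPath (G.src p b) p b := by
  induction l generalizing p q b with
  | nil => simp [normalForm] at h
  | cons g l ih =>
    cases l with
    | nil =>
      obtain ⟨rfl, rfl, rfl⟩ : (G.genNormalForm g).1 = p ∧ (G.genNormalForm g).2.1 = b ∧
          (G.genNormalForm g).2.2 = q := by
        simp only [normalForm, Option.some.injEq] at h
        simp [h]
      rcases g with a | e | e <;> simp [genNormalForm, IsPath, src]
    | cons k l =>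
      rw [normalForm_cons _ _ (by simp), Option.bind_eq_some_iff] at h
      obtain ⟨⟨p', b', q'⟩, h', h⟩ := h
      have hp := ih h'
      rcases g with a | e | e <;> rcases p' with _ | ⟨f, p'⟩ <;>
        grind [leftStep, src, IsPath]

open Classical in
/-- The trace of `p q*`, where the paths `p` and `q` have range `b`, for a given function `θ` on
the closed paths: it is `θ g` if `p = q g` for a closed path `g`, and zero otherwise. -/
noncomputable def pairTrace {K : Type w} [Zero K] (θ : List E → V → K) : List E × V × List E → K
  | (p, b, []) => if G.src p b = b then θ p b else 0
  | ([], _, _ :: _) => 0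
  | (e :: p, b, f :: q) => if e = f then pairTrace θ (p, b, q) else 0

/-- The trace of a product of generators. -/
noncomputable def wordTrace {K : Type w} [Zero K] (θ : List E → V → K)
    (l : List (LeavittGen V E)) : K :=
  (G.normalForm l).elim 0 (G.pairTrace θ)

section Trace

variable {G} {K : Type w} [AddCommMonoid K] {θ : List E → V → K}

theorem src_eq_src_of_pairTrace_ne_zero {p q : List E} {b : V}
    (h : G.pairTrace θ (p, b, q) ≠ 0) : G.src p b = G.src q b := by
  rcases p with _ | ⟨e, p⟩ <;> rcases q with _ | ⟨f, q⟩ <;> simp only [pairTrace] at h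
  · rfl
  · exact absurd rfl h
  · exact by_contra fun h' => h (if_neg h')
  · exact congrArg G.s (by_contra fun h' => h (if_neg h'))

/-- Cyclicity for a single generator. Monomials p q* with s(p) ≠ s(q) have trace zero, so a vertex
acts alike on both sides; an edge or ghost edge on one side cancels against its counterpart on the
other. Only an edge times a pure path changes the closed path, and there it is a rotation, covered
by `hθ`. -/
theorem pairTrace_leftStep
    (hθ : ∀ e p, G.src p (G.s e) = G.r e → θ (e :: p) (G.s e) = θ (p ++ [e]) (G.r e))
    (g : LeavittGen V E) (x : List E × V × List E) :
    (G.leftStep g x).elim 0 (G.pairTrace θ) = (G.rightStep g x).elim 0 (G.pairTrace θ) := by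
  obtain ⟨p, b, q⟩ := x
  have hsrc := fun p q => mt (src_eq_src_of_pairTrace_ne_zero (G := G) (θ := θ) (p := p)
    (q := q) (b := b))
  rcases g with a | e | e
  · simp only [leftStep, rightStep]
    by_cases h : G.src p b = G.src q b
    · rw [h]
    · have := not_ne_iff.1 (hsrc p q h)
      split_ifs <;> simp [this]
  · rcases q with _ | ⟨f, q⟩
    · simp only [leftStep, rightStep]
      by_cases h : G.s e = b
      · subst h
        by_cases h' : G.src p (G.s e) = G.r e
        · simp [h', pairTrace, hθ e p h']
        · simp [h', pairTrace]
      · split_ifs <;> simp [pairTrace, h]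
    · simp only [leftStep, rightStep]
      by_cases h : G.src p b = G.src q b
      · rw [h]
        by_cases h' : e = f <;> split_ifs <;> simp_all [pairTrace]
      · have := not_ne_iff.1 (hsrc p q h)
        split_ifs <;> simp [pairTrace, this]
  · rcases p with _ | ⟨f, p⟩
    · simp only [leftStep, rightStep]
      rcases q with _ | ⟨f, q⟩ <;> split_ifs <;> simp [pairTrace]
    · simp only [leftStep, rightStep]
      by_cases h : G.src p b = G.src q b
      · rw [h]
        by_cases h' : e = f <;> split_ifs <;> simp_all [pairTrace, eq_comm]
      · have := not_ne_iff.1 (hsrc p q h)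
        split_ifs <;> simp [pairTrace, this]

theorem wordTrace_cons
    (hθ : ∀ e p, G.src p (G.s e) = G.r e → θ (e :: p) (G.s e) = θ (p ++ [e]) (G.r e))
    (g : LeavittGen V E) (l : List (LeavittGen V E)) :
    G.wordTrace θ (g :: l) = G.wordTrace θ (l ++ [g]) := by
  by_cases hl : l = []
  · rw [hl]
    rfl
  · rw [wordTrace, wordTrace, normalForm_cons _ _ hl, normalForm_concat _ _ hl]
    cases G.normalForm l with
    | none => rfl
    | some x => exact pairTrace_leftStep hθ g x

theorem wordTrace_append_comm
    (hθ : ∀ e p, G.src p (G.s e) = G.r e → θ (e :: p) (G.s e) = θ (p ++ [e]) (G.r e))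
    (l m : List (LeavittGen V E)) : G.wordTrace θ (l ++ m) = G.wordTrace θ (m ++ l) := by
  induction l generalizing m with
  | nil => rw [List.append_nil, List.nil_append]
  | cons g l ih =>
    rw [List.cons_append, wordTrace_cons hθ, List.append_assoc, ih, List.append_assoc,
      List.singleton_append]

/-- Let the rest of the word be p q*. If p begins with f and s(f) = a, only the summand e = f
survives and returns p q*. If p is the vertex a and q is non-trivial, both sides are zero, since no
e is an extension of q e. For the bare vertex, e e* has trace θ(r(e)), and harmonicity is exactly
what is needed. -/
theorem wordTrace_ck2
    (hθ' : ∀ (a : V) (_ : {e : E | G.s e = a}.Nonempty) (hf : {e : E | G.s e = a}.Finite),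
      θ [] a = ∑ e ∈ hf.toFinset, θ [] (G.r e))
    (a : V) (hn : {e : E | G.s e = a}.Nonempty) (hf : {e : E | G.s e = a}.Finite)
    (l : List (LeavittGen V E)) :
    G.wordTrace θ (.vertex a :: l) =
      ∑ e ∈ hf.toFinset, G.wordTrace θ (.edge e :: .ghost e :: l) := by
  by_cases hl : l = []
  · subst hl
    have h := hθ' a hn hf
    simpa [wordTrace, normalForm, genNormalForm, leftStep, src, pairTrace] using h
  simp only [wordTrace, normalForm_cons G _ hl, normalForm_cons G _ (List.cons_ne_nil _ _),
    Option.bind_assoc]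
  cases hx : G.normalForm l with
  | none => simp
  | some x =>
    obtain ⟨p, b, q⟩ := x
    have hp := G.isPath_of_normalForm hx
    rcases p with _ | ⟨f, p⟩
    · by_cases hb : b = a
      · subst hb
        have hsum : ∀ e ∈ hf.toFinset, ((G.leftStep (.ghost e) ([], b, q)).bind
            (G.leftStep (.edge e))).elim 0 (G.pairTrace θ) =
            if q = [] then θ [] (G.r e) else 0 := by
          intro e he
          have he : G.s e = b := by simpa using he
          rcases q with _ | ⟨f, q⟩
          · simp [leftStep, he, src, pairTrace]
          · have : G.pairTrace θ ([], G.r e, q ++ [e]) = 0 := by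
              cases q <;> simp [pairTrace]
            simp [leftStep, he, src, pairTrace, this]
        simp only [Option.bind_some]
        rw [Finset.sum_congr rfl hsum]
        rcases q with _ | ⟨f, q⟩
        · simpa [leftStep, src, pairTrace] using hθ' b hn hf
        · simp [leftStep, src, pairTrace]
      · rw [Finset.sum_eq_zero]
        · simp [leftStep, src, hb]
        · intro e he
          have he : G.s e = a := by simpa using he
          simp [leftStep, he, Ne.symm hb]
    · have hp' : G.src p b = G.r f := by
        have := hp.2
        cases p with
        | nil => exact this.symm
        | cons f' p => exact this.1
      by_cases ha : G.s f = a
      · rw [Finset.sum_eq_single_of_mem f (by simpa using ha)]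
        · simp [leftStep, hp', ha]
        · intro e _ he
          simp [leftStep, he]
      · rw [Finset.sum_eq_zero]
        · simp [leftStep, src, ha]
        · intro e he
          have he : G.s e = a := by simpa using he
          have : e ≠ f := fun h => ha (h ▸ he)
          simp [leftStep, this]

theorem normalForm_path {a b : V} {p : List E} (hp : G.IsPath a p b) :
    G.normalForm (p.map .edge ++ [.vertex b]) = some (p, b, []) ∧ G.src p b = a := by
  induction p generalizing a with
  | nil => exact ⟨rfl, hp.symm⟩
  | cons e p ih =>
    obtain ⟨h, h'⟩ := ih hp.2
    refine ⟨?_, hp.1⟩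
    rw [List.map_cons, List.cons_append, normalForm_cons _ _ (by simp), h, Option.bind_some,
      leftStep, if_pos h']

open Classical in
theorem wordTrace_path {a b : V} {p : List E} (hp : G.IsPath a p b) :
    G.wordTrace θ (p.map .edge ++ [.vertex b]) = if a = b then θ p b else 0 := by
  obtain ⟨h, h'⟩ := normalForm_path hp
  rw [wordTrace, h, Option.elim_some, pairTrace, h']

/-- Reduces a relation g h = k under an arbitrary right factor to a check on generators and one on
monomials; the first covers the empty right factor, which has no normal form of its own. -/
theorem normalForm_cons_cons_eq {g h k : LeavittGen V E}
    (hgen : G.leftStep g (G.genNormalForm h) = some (G.genNormalForm k))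
    (hstep : ∀ x, (G.leftStep h x).bind (G.leftStep g) = G.leftStep k x)
    (l : List (LeavittGen V E)) : G.normalForm (g :: h :: l) = G.normalForm (k :: l) := by
  by_cases hl : l = []
  · subst hl
    exact hgen
  · rw [normalForm_cons _ _ (by simp), normalForm_cons _ _ hl, normalForm_cons _ _ hl,
      Option.bind_assoc]
    simp only [hstep]

theorem normalForm_cons_cons_eq_none {g h : LeavittGen V E}
    (hgen : G.leftStep g (G.genNormalForm h) = none)
    (hstep : ∀ x, (G.leftStep h x).bind (G.leftStep g) = none)
    (l : List (LeavittGen V E)) : G.normalForm (g :: h :: l) = none := by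
  by_cases hl : l = []
  · subst hl
    exact hgen
  · rw [normalForm_cons _ _ (by simp), normalForm_cons _ _ hl, Option.bind_assoc]
    simp only [hstep, Option.bind_fun_none]

end Trace

end DirectedGraph

/-! ### Traces on the Leavitt path algebra -/

namespace LeavittPathAlgebra

open DirectedGraph

variable {K : Type w} [Field K] {V : Type u} {E : Type v} {G : DirectedGraph V E}
  {θ : List E → V → K}

variable (G θ) in
/-- The linear functional on the free algebra that maps a word `m` to the trace of `m` times the
word `l`. -/
noncomputable def freeTrace (l : List (LeavittGen V E)) : LeavittFree K V E →ₗ[K] K :=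
  Finsupp.linearCombination K (fun m : FreeSemigroup (LeavittGen V E) =>
    G.wordTrace θ (m.head :: m.tail ++ l)) ∘ₗ (MonoidAlgebra.coeffLinearEquiv K).toLinearMap

theorem freeTrace_single (l : List (LeavittGen V E)) (m : FreeSemigroup (LeavittGen V E)) (k : K) :
    freeTrace G θ l (MonoidAlgebra.single m k) = k * G.wordTrace θ (m.head :: m.tail ++ l) := by
  simp [freeTrace]

theorem freeTrace_gen (l : List (LeavittGen V E)) (g : LeavittGen V E) :
    freeTrace G θ l (LeavittFree.gen K g) = G.wordTrace θ (g :: l) := by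
  rw [LeavittFree.gen, freeTrace_single, one_mul]
  rfl

theorem freeTrace_gen_mul_gen (l : List (LeavittGen V E)) (g h : LeavittGen V E) :
    freeTrace G θ l (LeavittFree.gen K g * LeavittFree.gen K h) =
      G.wordTrace θ (g :: h :: l) := by
  rw [LeavittFree.gen, LeavittFree.gen, MonoidAlgebra.single_mul_single, freeTrace_single,
    one_mul, one_mul]
  rfl

theorem freeTrace_mul_single (x : LeavittFree K V E) (m : FreeSemigroup (LeavittGen V E)) (k : K) :
    freeTrace G θ [] (x * MonoidAlgebra.single m k) =
      k * freeTrace G θ (m.head :: m.tail) x := by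
  induction x using MonoidAlgebra.induction_linear with
  | zero => simp
  | add x y hx hy => rw [add_mul, map_add, map_add, hx, hy, mul_add]
  | single m' k' =>
    rw [MonoidAlgebra.single_mul_single, freeTrace_single, freeTrace_single, List.append_nil,
      FreeSemigroup.head_mul, FreeSemigroup.tail_mul, List.cons_append, mul_assoc,
      mul_left_comm]

theorem freeTrace_mul_comm
    (hθ : ∀ e p, G.src p (G.s e) = G.r e → θ (e :: p) (G.s e) = θ (p ++ [e]) (G.r e))
    (x y : LeavittFree K V E) : freeTrace G θ [] (x * y) = freeTrace G θ [] (y * x) := by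
  induction y using MonoidAlgebra.induction_linear with
  | zero => simp
  | add y z hy hz => rw [mul_add, add_mul, map_add, map_add, hy, hz]
  | single m k =>
    induction x using MonoidAlgebra.induction_linear with
    | zero => simp
    | add x z hx hz => rw [mul_add, add_mul, map_add, map_add, hx, hz]
    | single m' k' =>
      rw [freeTrace_mul_single, freeTrace_mul_single, freeTrace_single, freeTrace_single,
        wordTrace_append_comm hθ, mul_left_comm]

theorem freeTrace_eq_of_rel
    (hθ' : ∀ (a : V) (_ : {e : E | G.s e = a}.Nonempty) (hf : {e : E | G.s e = a}.Finite),
      θ [] a = ∑ e ∈ hf.toFinset, θ [] (G.r e))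
    (l : List (LeavittGen V E)) {x y : LeavittFree K V E} (h : G.LeavittRel K x y) :
    freeTrace G θ l x = freeTrace G θ l y := by
  have eq : ∀ g h k : LeavittGen V E,
      G.leftStep g (G.genNormalForm h) = some (G.genNormalForm k) →
      (∀ x, (G.leftStep h x).bind (G.leftStep g) = G.leftStep k x) →
      freeTrace G θ l (LeavittFree.gen K g * LeavittFree.gen K h) =
        freeTrace G θ l (LeavittFree.gen K k) := fun g h k h₁ h₂ => by
    rw [freeTrace_gen_mul_gen, freeTrace_gen, wordTrace, wordTrace,
      normalForm_cons_cons_eq h₁ h₂]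
  have eq_zero : ∀ g h : LeavittGen V E, G.leftStep g (G.genNormalForm h) = none →
      (∀ x, (G.leftStep h x).bind (G.leftStep g) = none) →
      freeTrace G θ l (LeavittFree.gen K g * LeavittFree.gen K h) =
        freeTrace G θ l 0 := fun g h h₁ h₂ => by
    rw [freeTrace_gen_mul_gen, map_zero, wordTrace, normalForm_cons_cons_eq_none h₁ h₂]
    rfl
  induction h with
  | smul k x y _ ih => rw [map_smul, map_smul, ih]
  | ck2 a hn hf =>
    simp only [LeavittFree.vtx, LeavittFree.edge, LeavittFree.ghost, map_sum, freeTrace_gen,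
      freeTrace_gen_mul_gen]
    exact wordTrace_ck2 hθ' a hn hf l
  | vertex_self a =>
    refine eq _ _ _ (by simp [leftStep, genNormalForm]) fun ⟨p, b, q⟩ => ?_
    by_cases h : G.src p b = a <;> simp [leftStep, h]
  | vertex_ne a b hab =>
    refine eq_zero _ _ (by simp [leftStep, genNormalForm, hab.symm]) fun ⟨p, c, q⟩ => ?_
    by_cases h : G.src p c = b <;> simp [leftStep, h, hab.symm]
  | source_edge e =>
    refine eq _ _ _ (by simp [leftStep, genNormalForm]) fun ⟨p, b, q⟩ => ?_
    by_cases h : G.src p b = G.r e <;> simp [leftStep, h]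
  | edge_range e =>
    refine eq _ _ _ (by simp [leftStep, genNormalForm]) fun ⟨p, b, q⟩ => ?_
    by_cases h : G.src p b = G.r e <;> simp [leftStep, h]
  | range_ghost e =>
    refine eq _ _ _ (by simp [leftStep, genNormalForm]) fun ⟨p, b, q⟩ => ?_
    rcases p with _ | ⟨f, p⟩
    · by_cases h : G.s e = b <;> simp [leftStep, h]
    · by_cases h : e = f ∧ G.src p b = G.r e <;> simp [leftStep, h]
  | ghost_source e =>
    refine eq _ _ _ (by simp [leftStep, genNormalForm]) fun ⟨p, b, q⟩ => ?_
    rcases p with _ | ⟨f, p⟩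
    · by_cases h : b = G.s e
      · simp [leftStep, h]
      · simp [leftStep, h, Ne.symm h]
    · by_cases h : e = f
      · subst h
        simp [leftStep]
      · by_cases h' : G.s f = G.s e <;> simp [leftStep, h, h']
  | ck1_self e =>
    refine eq _ _ _ (by simp [leftStep, genNormalForm]) fun ⟨p, b, q⟩ => ?_
    by_cases h : G.src p b = G.r e <;> simp [leftStep, h]
  | ck1_ne e f hef =>
    refine eq_zero _ _ (by simp [leftStep, genNormalForm, hef]) fun ⟨p, b, q⟩ => ?_
    by_cases h : G.src p b = G.r f <;> simp [leftStep, h, hef]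

theorem exists_single_eq_path {a b : V} {p : List E} (hp : G.IsPath a p b) :
    ∃ m : FreeSemigroup (LeavittGen V E), m.head :: m.tail = p.map .edge ++ [.vertex b] ∧
      path K G a p = mk K G (MonoidAlgebra.single m 1) := by
  induction p generalizing a with
  | nil =>
    cases hp
    exact ⟨.of (.vertex b), rfl, rfl⟩
  | cons e p ih =>
    obtain ⟨m, hm, h⟩ := ih hp.2
    refine ⟨.of (.edge e) * m, ?_, ?_⟩
    · rw [List.map_cons, List.cons_append, ← hm]
      rfl
    · rw [path, h, edge, ← mk_mul, LeavittFree.edge, LeavittFree.gen,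
        MonoidAlgebra.single_mul_single, one_mul]

/-- A function on the closed paths that is invariant under rotation, and harmonic on the vertices,
extends to a trace on the Leavitt path algebra. -/
theorem exists_trace
    (hθ : ∀ e p, G.src p (G.s e) = G.r e → θ (e :: p) (G.s e) = θ (p ++ [e]) (G.r e))
    (hθ' : ∀ (a : V) (_ : {e : E | G.s e = a}.Nonempty) (hf : {e : E | G.s e = a}.Finite),
      θ [] a = ∑ e ∈ hf.toFinset, θ [] (G.r e)) :
    ∃ τ : LeavittPathAlgebra K G →+ K, (∀ x y, τ (x * y) = τ (y * x)) ∧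
      ∀ a p, G.IsPath a p a → τ (path K G a p) = θ p a := by
  -- The radical of the trace form. Both conditions are needed because the free algebra has no unit;
  -- cyclicity of the trace makes the set a two-sided ideal.
  let J : TwoSidedIdeal (LeavittFree K V E) := .mk'
    {x | freeTrace G θ [] x = 0 ∧ ∀ y, freeTrace G θ [] (x * y) = 0}
    ⟨map_zero _, fun y => by rw [zero_mul, map_zero]⟩
    (fun hx hy => ⟨by rw [map_add, hx.1, hy.1, add_zero],
      fun z => by rw [add_mul, map_add, hx.2, hy.2, add_zero]⟩)
    (fun hx => ⟨by rw [map_neg, hx.1, neg_zero],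
      fun z => by rw [neg_mul, map_neg, hx.2, neg_zero]⟩)
    (fun {x y} hy => ⟨by rw [freeTrace_mul_comm hθ, hy.2],
      fun z => by rw [mul_assoc, freeTrace_mul_comm hθ, mul_assoc, hy.2]⟩)
    (fun {x y} hx => ⟨hx.2 y, fun z => by rw [mul_assoc, hx.2]⟩)
  have hJ : G.leavittCon K ≤ J.ringCon := by
    refine RingCon.ringConGen_le.2 fun x y h => ?_
    rw [TwoSidedIdeal.rel_iff, TwoSidedIdeal.mem_mk']
    refine ⟨by rw [map_sub, freeTrace_eq_of_rel hθ' [] h, sub_self], fun z => ?_⟩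
    induction z using MonoidAlgebra.induction_linear with
    | zero => rw [mul_zero, map_zero]
    | add z w hz hw => rw [mul_add, map_add, hz, hw, add_zero]
    -- A right factor that is a word is absorbed into the index of `freeTrace`, for which the
    -- relations have been checked.
    | single m k =>
      rw [freeTrace_mul_single, map_sub, freeTrace_eq_of_rel hθ' _ h, sub_self, mul_zero]
  have hle : ∀ x y, G.leavittCon K x y → freeTrace G θ [] x = freeTrace G θ [] y := by
    intro x y h
    have h' := hJ h
    rw [TwoSidedIdeal.rel_iff, TwoSidedIdeal.mem_mk'] at h'
    rw [← sub_eq_zero, ← map_sub]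
    exact h'.1
  refine ⟨{ toFun := Quotient.lift (freeTrace G θ []) hle, map_zero' := map_zero (freeTrace G θ []),
            map_add' := fun x y => ?_ }, fun x y => ?_, fun a p hp => ?_⟩
  · obtain ⟨x, rfl⟩ := mk_surjective G x
    obtain ⟨y, rfl⟩ := mk_surjective G y
    exact map_add (freeTrace G θ []) x y
  · obtain ⟨x, rfl⟩ := mk_surjective G x
    obtain ⟨y, rfl⟩ := mk_surjective G y
    exact freeTrace_mul_comm hθ x y
  · obtain ⟨m, hm, h⟩ := exists_single_eq_path (K := K) hp
    rw [h]
    change freeTrace G θ [] (MonoidAlgebra.single m 1) = _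
    rw [freeTrace_single, one_mul, hm, List.append_nil, wordTrace_path hp, if_pos rfl]

end LeavittPathAlgebra

/-! ### Commutator rings force acyclicity and row-finiteness -/

theorem IsCommutatorRing.apply_eq_zero {R : Type u} [NonUnitalRing R] (hR : IsCommutatorRing R)
    {A : Type*} [AddCommGroup A] (τ : R →+ A) (hτ : ∀ x y, τ (x * y) = τ (y * x)) (x : R) :
    τ x = 0 := by
  have : AddSubgroup.closure {z : R | ∃ x y : R, z = x * y - y * x} ≤ τ.ker := by
    rw [AddSubgroup.closure_le]
    rintro _ ⟨x, y, rfl⟩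
    exact (map_sub τ _ _).trans (sub_eq_zero.2 (hτ x y))
  exact this (hR ▸ AddSubgroup.mem_top x)

namespace DirectedGraph

variable {V : Type u} {E : Type v} {G : DirectedGraph V E}

/-- A non-empty set of vertices in an acyclic graph, if finite, has an element that receives no
edge from the set. -/
theorem Acyclic.exists_source_mem (hG : G.Acyclic) {F : Finset V} (hF : F.Nonempty) :
    ∃ a ∈ F, ∀ e, G.s e ∈ F → G.r e ≠ a := by
  -- By acyclicity, reachability by a non-trivial path is a strict order on the finite set; a
  -- minimal element is sought.
  let R : F → F → Prop := fun a b => ∃ p, p ≠ [] ∧ G.IsPath a p b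
  have : IsTrans F R := ⟨fun a b c ⟨p, hp, hp'⟩ ⟨q, _, hq'⟩ =>
    ⟨p ++ q, by simp [hp], hp'.append hq'⟩⟩
  have : Std.Irrefl R := ⟨fun a ⟨p, hp, hp'⟩ => hp (hG.eq_nil_of_isPath hp')⟩
  have hwf : WellFounded R := Finite.wellFounded_of_trans_of_irrefl R
  obtain ⟨a, ha⟩ := hF
  obtain ⟨b, -, hb⟩ := hwf.has_min Set.univ ⟨⟨a, ha⟩, trivial⟩
  exact ⟨b, b.2, fun e he hr => hb ⟨G.s e, he⟩ trivial ⟨[e], by simp, rfl, hr⟩⟩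

/-- In an acyclic graph, for each infinite emitter there is a function on the vertices which is
harmonic and does not vanish at that vertex. -/
theorem Acyclic.exists_harmonic (K : Type w) [Field K] (hG : G.Acyclic) {c : V}
    (hc : ¬ {e : E | G.s e = c}.Finite) :
    ∃ φ : V → K, φ c ≠ 0 ∧
      ∀ (a : V) (_ : {e : E | G.s e = a}.Nonempty) (hf : {e : E | G.s e = a}.Finite),
        φ a = ∑ e ∈ hf.toFinset, φ (G.r e) := by
  classical
  -- A harmonic function is a linear functional killing every `d a` with `a` a non-sink. Sinks are
  -- included too, where `d a` is `a` itself, so the function found also vanishes at sinks.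
  let d : {a : V // {e : E | G.s e = a}.Finite} → V →₀ K := fun a =>
    Finsupp.single a.1 1 - ∑ e ∈ a.2.toFinset, Finsupp.single (G.r e) 1
  let S : Submodule K (V →₀ K) := Submodule.span K (Set.range d)
  have hS : Finsupp.single c 1 ∉ S := by
    intro h
    obtain ⟨k, hk⟩ := Finsupp.mem_span_range_iff_exists_finsupp.1 h
    have hk0 : k ≠ 0 := by
      rintro rfl
      rw [Finsupp.sum_zero_index] at hk
      exact one_ne_zero (Finsupp.single_eq_zero.1 hk.symm)
    have hne : (k.support.image Subtype.val).Nonempty :=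
      (Finsupp.support_nonempty_iff.2 hk0).image _
    obtain ⟨b, hb, hmin⟩ := hG.exists_source_mem hne
    obtain ⟨a, ha, rfl⟩ := Finset.mem_image.1 hb
    -- No edge from the support of `k` ends at `a`, so the coefficient of `a` in the combination is
    -- just `k a`. It is non-zero, but `a` is not the infinite emitter `c`: a contradiction.
    have hval : ∀ a' ∈ k.support, (k a' • d a') a.1 = if a' = a then k a else 0 := by
      intro a' ha'
      have hr : ∀ e ∈ a'.2.toFinset, (Finsupp.single (G.r e) (1 : K)) a.1 = 0 := by
        intro e he
        have he : G.s e = a'.1 := by simpa using he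
        exact Finsupp.single_eq_of_ne
          (hmin e (he ▸ Finset.mem_image_of_mem _ ha')).symm
      simp only [d, Finsupp.smul_apply, Finsupp.sub_apply, Finsupp.finsetSum_apply]
      rw [Finset.sum_eq_zero hr, sub_zero]
      by_cases h : a' = a
      · simp [h]
      · rw [if_neg h, Finsupp.single_eq_of_ne fun h' => h (Subtype.ext h'.symm), smul_zero]
    have hca : a.1 ≠ c := fun h => hc (h ▸ a.2)
    have := DFunLike.congr_fun hk a.1
    rw [Finsupp.sum, Finsupp.finsetSum_apply, Finset.sum_congr rfl hval,
      Finset.sum_ite_eq_of_mem' _ _ _ ha, Finsupp.single_eq_of_ne hca] at this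
    exact Finsupp.mem_support_iff.1 ha this
  obtain ⟨f, hf, hfS⟩ := Submodule.exists_le_ker_of_notMem hS
  refine ⟨fun a => f (Finsupp.single a 1), hf, fun a _ ha => ?_⟩
  have : f (d ⟨a, ha⟩) = 0 := hfS (Submodule.subset_span ⟨_, rfl⟩)
  rwa [map_sub, map_sum, sub_eq_zero] at this

variable {K : Type w} [Field K]

/-- Take θ to be the indicator of the closed paths as long as the given cycle. Length is invariant
under rotation, and θ vanishes on vertices because a cycle has positive length, so harmonicity is
trivial. -/
theorem acyclic_of_isCommutatorRing (h : IsCommutatorRing (LeavittPathAlgebra K G)) :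
    G.Acyclic := by
  rintro p ⟨hp, ⟨a, ha⟩, -⟩
  have hp : p.length ≠ 0 := fun h => hp (List.length_eq_zero_iff.1 h)
  obtain ⟨τ, hτ, hτp⟩ := LeavittPathAlgebra.exists_trace (K := K) (G := G)
    (θ := fun q _ => if q.length = p.length then 1 else 0)
    (fun e q _ => by simp) (fun a _ _ => by simp [hp.symm])
  have := hτp a p ha
  rw [h.apply_eq_zero τ hτ, if_pos rfl] at this
  exact zero_ne_one this

/-- Extend the harmonic function by zero to closed paths of positive length; rotation preserves
length, and the resulting trace is non-zero at the infinite emitter. -/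
theorem rowFinite_of_isCommutatorRing (h : IsCommutatorRing (LeavittPathAlgebra K G)) :
    G.RowFinite := by
  intro c
  by_contra hc
  obtain ⟨φ, hφ, hφ'⟩ := (acyclic_of_isCommutatorRing h).exists_harmonic K hc
  obtain ⟨τ, hτ, hτp⟩ := LeavittPathAlgebra.exists_trace (K := K) (G := G)
    (θ := fun q b => if q.isEmpty then φ b else 0)
    (fun e q _ => by simp) (fun a hn hf => by simpa using hφ' a hn hf)
  have := hτp c [] rfl
  rw [h.apply_eq_zero τ hτ] at this
  exact hφ this.symm

end DirectedGraph

theorem mainTheorem8 {K : Type w} [Field K] {V : Type u} {E : Type v} (G : DirectedGraph V E) :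
    (G.Acyclic → G.RowFinite →
      Nonempty (G.HereditarySaturated ≃o TwoSidedIdeal (LeavittPathAlgebra K G))) ∧
    (IsCommutatorRing (LeavittPathAlgebra K G) →
      Nonempty (G.HereditarySaturated ≃o TwoSidedIdeal (LeavittPathAlgebra K G))) :=
  ⟨fun hG hR => ⟨LeavittPathAlgebra.hereditarySaturatedOrderIso hG hR⟩,
    fun h => ⟨LeavittPathAlgebra.hereditarySaturatedOrderIso
      (DirectedGraph.acyclic_of_isCommutatorRing h)
      (DirectedGraph.rowFinite_of_isCommutatorRing h)⟩⟩
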